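/- Let $\Gamma$ be a countable group and let $(X,T)$ be a $\Gamma$-dynamical system: $X$ is a compact metric space and $T:\Gamma\to\mathrm{Homeo}(X)$, $\gamma\mapsto T_\gamma$, is a group homomorphism. Let $\mathrm{Prob}(X,T)$ be the set of $T$-invariant Borel probability measures on $X$ and let $\mathrm{Cov}(X)$ be the set of finite open covers of $X$. Write $\mathcal V\succeq\mathcal U$ if every element of $\mathcal V$ is contained in some element of $\mathcal U$. Define $$\dim(X,T)=\sup_{\mathcal U\in\mathrm{Cov}(X)}\ \inf_{\substack{\mathcal V\in\mathrm{Cov}(X)\\ \mathcal V\succeq\mathcal U}}\ \sup_{\mu\in\mathrm{Prob}(X,T)}\int_X\Big(-1+\sum_{V\in\mathcal V}\mathbf 1_V(x)\Big)\,d\mu(x)\in[-\infty,+\infty],$$ with $\dim(X,T)=-\infty$ if $\mathrm{Prob}(X,T)=\emptyset$. For $d\in\mathbb N=\{0,1,2,\dots\}$ let $\Gamma$ act on $([0,1]^d)^\Gamma$ (with the product topology) by the left shift $(\mathrm{shift}_\gamma(y))_{\gamma'}=y_{\gamma^{-1}\gamma'}$, and for $f\in C(X,[0,1]^d)$ let $f^\Gamma:X\to([0,1]^d)^\Gamma$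 be given by $f^\Gamma(x)_\gamma=f(T_{\gamma^{-1}}(x))$. A continuous equivariant map $\pi:X\to Y$ between $\Gamma$-dynamical systems $(X,T)$ and $(Y,S)$ is called an almost embedding if for every $\mu\in\mathrm{Prob}(X,T)$ it induces a measure-theoretic isomorphism of $(X,T,\mu)$ and $(Y,S,\pi_*\mu)$, that is, there are invariant Borel sets $X_0\subseteq X$ and $Y_0\subseteq Y$ with $\mu(X_0)=1=\pi_*\mu(Y_0)$ such that $\pi$ restricts to a bijection $X_0\to Y_0$ which is measurable with measurable inverse. Theorem. If $\dim(X,T)<\frac d2$, then there is a dense $G_\delta$ set $G\subseteq C(X,[0,1]^d)$ (in the topology of uniform convergence) such that for every $f\in G$ the map $f^\Gamma:X\to([0,1]^d)^\Gamma$ is an almost embedding of $(X,T)$ into $(([0,1]^d)^\Gamma,\mathrm{shift})$. -/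

import Mathlib

open MeasureTheory

namespace DynDim

section Dimension

variable {X : Type*} [TopologicalSpace X]

/-- `Cov X`: the finite open covers of `X`. -/
def Cov (X : Type*) [TopologicalSpace X] : Set (Finset (Set X)) :=
  {𝒰 | (∀ U ∈ 𝒰, IsOpen U) ∧ ∀ x : X, ∃ U ∈ 𝒰, x ∈ U}

/-- `Refines 𝒱 𝒰` : every element of `𝒱` is contained in some element of `𝒰`. -/
def Refines (𝒱 𝒰 : Finset (Set X)) : Prop :=
  ∀ V ∈ 𝒱, ∃ U ∈ 𝒰, V ⊆ U

/-- `ord(𝒱, x) = -1 + ∑_{V ∈ 𝒱} 1_V(x)`. -/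
noncomputable def ordAt (𝒱 : Finset (Set X)) (x : X) : ℝ :=
  -1 + ∑ V ∈ 𝒱, V.indicator (fun _ => (1 : ℝ)) x

variable [MeasurableSpace X]

/-- `ord(𝒱, P) = sup_{μ ∈ P} ∫ ord(𝒱, x) dμ(x)`, an extended real.
For a finite collection of Borel sets the integrand is bounded and Borel, hence integrable. -/
noncomputable def ordOf (𝒱 : Finset (Set X)) (P : Set (ProbabilityMeasure X)) : EReal :=
  ⨆ μ ∈ P, ((∫ x, ordAt 𝒱 x ∂(μ : Measure X) : ℝ) : EReal)

/-- `dim(𝒰, P) = inf ord(𝒱, P)`, over the finite open covers `𝒱` refining `𝒰`. -/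
noncomputable def dimCover (𝒰 : Finset (Set X)) (P : Set (ProbabilityMeasure X)) : EReal :=
  ⨅ 𝒱 ∈ {𝒱 ∈ Cov X | Refines 𝒱 𝒰}, ordOf 𝒱 P

/-- `dim(X, P) = sup_{𝒰 ∈ Cov X} dim(𝒰, P)`; see `dimPair_empty` for `P = ∅`. -/
noncomputable def dimPair (P : Set (ProbabilityMeasure X)) : EReal :=
  ⨆ 𝒰 ∈ Cov X, dimCover 𝒰 P

/-- The convention `dim(X, ∅) = -∞` holds automatically. -/
theorem dimPair_empty : dimPair (∅ : Set (ProbabilityMeasure X)) = ⊥ := by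
  refine le_bot_iff.1 (iSup₂_le fun 𝒰 h => ?_)
  refine (iInf₂_le 𝒰 ⟨h, fun V hV => ⟨V, hV, subset_rfl⟩⟩).trans ?_
  simp [ordOf]

end Dimension

section Dynamics

variable {Γ : Type*} [Group Γ] {X : Type*} [TopologicalSpace X] {Y : Type*} [TopologicalSpace Y]

/-- `Prob(X, T)`: the `T`-invariant Borel probability measures on `X`. -/
def invProb [MeasurableSpace X] (T : Γ →* (X ≃ₜ X)) : Set (ProbabilityMeasure X) :=
  {μ | ∀ γ : Γ, Measure.map (T γ) (μ : Measure X) = (μ : Measure X)}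

/-- `dim(X, T) = dim(X, Prob(X, T))`. -/
noncomputable def dimSys [MeasurableSpace X] (T : Γ →* (X ≃ₜ X)) : EReal :=
  dimPair (invProb T)

/-- `f` induces a measure-theoretic isomorphism from `(X, T, μ)` onto `(Y, S, f_* μ)`: it restricts
to an equivariant bi-measurable bijection between invariant measurable sets of full measure.
(The restriction carries `μ` to `f_* μ` by definition of the latter.) -/
def InducesMeasureIso [MeasurableSpace X] [MeasurableSpace Y]
    (T : Γ →* (X ≃ₜ X)) (S : Γ →* (Y ≃ₜ Y)) (μ : Measure X) (f : X → Y) : Prop :=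
  Measurable f ∧
    ∃ (X₀ : Set X) (Y₀ : Set Y),
      MeasurableSet X₀ ∧ MeasurableSet Y₀ ∧
      μ X₀ᶜ = 0 ∧ (Measure.map f μ) Y₀ᶜ = 0 ∧
      (∀ γ : Γ, T γ '' X₀ = X₀) ∧ (∀ γ : Γ, S γ '' Y₀ = Y₀) ∧
      (∀ γ : Γ, ∀ x ∈ X₀, f (T γ x) = S γ (f x)) ∧
      ∃ e : X₀ ≃ᵐ Y₀, ∀ x : X₀, (e x : Y) = f x

/-- Almost embedding of `(X, T)` into `(Y, S)`: a continuous equivariant map inducing a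
measure-theoretic isomorphism with respect to every invariant probability measure. -/
structure IsAlmostEmbedding [MeasurableSpace X] [MeasurableSpace Y]
    (T : Γ →* (X ≃ₜ X)) (S : Γ →* (Y ≃ₜ Y)) (f : X → Y) : Prop where
  continuous : Continuous f
  equivariant : ∀ (γ : Γ) (x : X), f (T γ x) = S γ (f x)
  measureIso : ∀ μ ∈ invProb T, InducesMeasureIso T S (μ : Measure X) f

/-- The left shift action of `Γ` on `K^Γ`: `(shift_γ x)_{γ'} = x_{γ⁻¹ γ'}`. -/
def shift (Γ : Type*) [Group Γ] (K : Type*) [TopologicalSpace K] :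
    Γ →* ((Γ → K) ≃ₜ (Γ → K)) where
  toFun γ :=
    { toFun := fun x γ' => x (γ⁻¹ * γ')
      invFun := fun x γ' => x (γ * γ')
      left_inv := fun x => by funext γ'; simp
      right_inv := fun x => by funext γ'; simp
      continuous_toFun := by fun_prop
      continuous_invFun := by fun_prop }
  map_one' := by ext x γ'; simp
  map_mul' γ₁ γ₂ := by ext x γ'; simp [mul_assoc]

/-- `f^Γ : X → K^Γ`, `f^Γ(x)_γ = f(T_{γ⁻¹} x)`; with the left shift on `K^Γ` this is the
equivariant map whose coordinate at the identity is `f`. -/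
def orbitMap {K : Type*} (T : Γ →* (X ≃ₜ X)) (f : X → K) : X → (Γ → K) :=
  fun x γ => f (T γ⁻¹ x)

end Dynamics

end DynDim

/-! Fix a real `c` with dim `< c < d/2`. A cover `𝒱` of order `< c` against every invariant measure
is realised by a map `g` near `f`: average points of the cube in general position with a partition
of unity. Then `g x = g y` is an affine relation among the points of the members containing `x` or
`y`. If the orders at `x` and `y` sum to less than `d`, at most `d + 1` points occur, so the
relation is trivial and `x`, `y` share a member of `𝒱`. Such separation at every scale `1/(n+1)` is
a dense `Gδ` condition by Baire.

For such `f`, take a probability measure on `X × X` with invariant marginals and `f x = f y` almost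
surely. The orders sum to less than `2c < d` on average, so by Markov the diagonal has positive mass
(`measure_diagonal_ne_zero`). Were the relatively independent self-joining of `μ` over `f^Γ` to
charge the invariant complement of the diagonal, conditioning on that complement would contradict
this. So the self-joining lives on the diagonal, every Borel set is a preimage mod `μ`, and `f^Γ` is
injective on a conull set. -/

namespace DynDim

/-! ### Points in general position in the cube -/

section GeneralPosition

/-- At most `d` points span a proper affine subspace, which is Lebesgue null; finitely many of these
cannot cover a nonempty open set. -/
theorem exists_mem_notMem_affineSpan_of_card_le {α : Type*} {d : ℕ} (s : Finset α)
    (p : α → Fin d → ℝ) {U : Set (Fin d → ℝ)} (hU : IsOpen U) (hne : U.Nonempty) :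
    ∃ x ∈ U, ∀ t ⊆ s, t.card ≤ d → x ∉ affineSpan ℝ (p '' t) := by
  classical
  have hnull : volume (⋃ t ∈ s.powerset.filter (fun t => t.card ≤ d),
      (affineSpan ℝ (p '' (t : Set α)) : Set (Fin d → ℝ))) = 0 := by
    refine (measure_biUnion_null_iff (Finset.countable_toSet _)).2 fun t ht => ?_
    have htd : t.card ≤ d := (Finset.mem_filter.1 ht).2
    rcases t.eq_empty_or_nonempty with rfl | hne
    · simp
    refine Measure.addHaar_affineSubspace _ _ fun htop => ?_
    obtain ⟨n, hn⟩ : ∃ n, t.card = n + 1 := ⟨t.card - 1, by have := hne.card_pos; omega⟩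
    have h1 := finrank_vectorSpan_image_finset_le ℝ p t hn
    have h2 : vectorSpan ℝ (t.image p : Set (Fin d → ℝ)) = ⊤ := by
      rw [← direction_affineSpan, Finset.coe_image, htop, AffineSubspace.direction_top]
    rw [h2, finrank_top, Module.finrank_fin_fun] at h1
    omega
  have hpos := hU.measure_pos volume hne
  by_contra! hcon
  refine hpos.ne' (measure_mono_null (fun x hx => ?_) hnull)
  obtain ⟨t, hts, htd, hxt⟩ := hcon x hx
  simp only [Set.mem_iUnion]
  exact ⟨t, by simp [hts, htd], hxt⟩

theorem exists_generalPosition {α : Type*} {d : ℕ} (s : Finset α) (U : α → Set (Fin d → ℝ))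
    (hU : ∀ i, IsOpen (U i)) (hne : ∀ i, (U i).Nonempty) :
    ∃ p : α → Fin d → ℝ, (∀ i, p i ∈ U i) ∧ ∀ w : α → ℝ, ∑ i ∈ s, w i = 0 →
      ∑ i ∈ s, w i • p i = 0 → (s.filter (fun i => w i ≠ 0)).card ≤ d + 1 →
      ∀ i ∈ s, w i = 0 := by
  classical
  induction s using Finset.induction_on with
  | empty => exact ⟨fun i => (hne i).some, fun i => (hne i).some_mem, by simp⟩
  | insert a s ha ih =>
    obtain ⟨p, hpU, hp⟩ := ih
    obtain ⟨x, hxU, hx⟩ := exists_mem_notMem_affineSpan_of_card_le s p (hU a) (hne a)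
    have hpx : ∀ i ∈ s, Function.update p a x i = p i := fun i hi =>
      Function.update_of_ne (ne_of_mem_of_not_mem hi ha) _ _
    refine ⟨Function.update p a x, fun i => ?_, fun w hw hwp hcard => ?_⟩
    · rcases eq_or_ne i a with rfl | h
      · simpa using hxU
      · simpa [h] using hpU i
    rw [Finset.sum_insert ha] at hw hwp
    rw [Function.update_self, Finset.sum_congr rfl fun i hi => by rw [hpx i hi]] at hwp
    -- Otherwise solving for `x` makes it an affine combination of at most `d` earlier points.
    have hwa : w a = 0 := by
      by_contra hwa
      rw [Finset.filter_insert, if_pos hwa, Finset.card_insert_of_notMem (by simp [ha])] at hcard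
      set t := s.filter (fun i => w i ≠ 0) with ht
      have hts : ∀ {M : Type} [AddCommMonoid M] (F : α → M), (∀ i, w i = 0 → F i = 0) →
          ∑ i ∈ t, F i = ∑ i ∈ s, F i := fun F hF =>
        Finset.sum_filter_of_ne fun i _ hi h => hi (hF i h)
      refine hx t (Finset.filter_subset _ _) (by omega) ?_
      have hsum : ∑ i ∈ t, (-(w a)⁻¹ * w i) = 1 := by
        rw [hts _ (by simp +contextual), ← Finset.mul_sum, eq_neg_of_add_eq_zero_right hw]
        field_simp
      have hmem := affineCombination_mem_affineSpan_image (s := t) hsum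
        (s' := (t : Set α)) (fun i hi hit => absurd hi hit) p
      rw [Finset.affineCombination_eq_linear_combination _ _ _ hsum] at hmem
      convert hmem using 1
      rw [hts _ (by simp +contextual)]
      simp_rw [mul_smul]
      rw [← Finset.smul_sum, eq_neg_of_add_eq_zero_right hwp, smul_neg, neg_smul, neg_neg,
        smul_smul, inv_mul_cancel₀ hwa, one_smul]
    rw [hwa, zero_add] at hw
    rw [hwa, zero_smul, zero_add] at hwp
    have := hp w hw hwp (le_trans (Finset.card_le_card
      (Finset.filter_subset_filter _ (Finset.subset_insert _ _))) hcard)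
    intro i hi
    rcases Finset.mem_insert.1 hi with rfl | hi
    exacts [hwa, this i hi]

theorem exists_generalPosition_unitCube {α : Type*} {d : ℕ} (s : Finset α)
    (q : α → Fin d → unitInterval) {δ : ℝ} (hδ : 0 < δ) :
    ∃ p : α → Fin d → unitInterval, (∀ i, dist (p i) (q i) < δ) ∧ ∀ w : α → ℝ,
      ∑ i ∈ s, w i = 0 → (∀ j, ∑ i ∈ s, w i * p i j = 0) →
      (s.filter (fun i => w i ≠ 0)).card ≤ d + 1 → ∀ i ∈ s, w i = 0 := by
  -- Moving into the interior of the cube gives nonempty open subsets of `ℝ^d` even when `q i` is on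
  -- the boundary.
  have hint : ∀ r : unitInterval, (Set.Ioo (0 : ℝ) 1 ∩ Metric.ball (r : ℝ) δ).Nonempty := by
    intro r
    have hr : (r : ℝ) ∈ closure (Set.Ioo (0 : ℝ) 1) := by
      rw [closure_Ioo zero_ne_one]; exact r.2
    obtain ⟨y, hy, hyd⟩ := Metric.mem_closure_iff.1 hr δ hδ
    exact ⟨y, hy, by rwa [Metric.mem_ball, dist_comm]⟩
  obtain ⟨p, hpU, hp⟩ := exists_generalPosition s
    (fun i => Set.pi Set.univ fun j => Set.Ioo (0 : ℝ) 1 ∩ Metric.ball (q i j : ℝ) δ)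
    (fun i => isOpen_set_pi Set.finite_univ fun j _ => isOpen_Ioo.inter Metric.isOpen_ball)
    (fun i => Set.univ_pi_nonempty_iff.2 fun j => hint _)
  refine ⟨fun i j => ⟨p i j, Set.Ioo_subset_Icc_self (hpU i j trivial).1⟩, fun i => ?_,
    fun w hw hwp => hp w hw ?_⟩
  · exact (dist_pi_lt_iff hδ).2 fun j => (hpU i j trivial).2
  · ext j
    simpa using hwp j

end GeneralPosition

/-! ### The order function of a cover -/

section Order

variable {X : Type*}

open Classical in
theorem ordAt_eq_card (𝒱 : Finset (Set X)) (x : X) :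
    ordAt 𝒱 x = -1 + ((𝒱.filter (fun V => x ∈ V)).card : ℝ) := by
  simp [ordAt, Set.indicator_apply]

theorem ordAt_nonneg [TopologicalSpace X] {𝒱 : Finset (Set X)} (h𝒱 : 𝒱 ∈ Cov X) (x : X) :
    0 ≤ ordAt 𝒱 x := by
  classical
  obtain ⟨V, hV, hx⟩ := h𝒱.2 x
  have : 0 < (𝒱.filter (fun V => x ∈ V)).card :=
    Finset.card_pos.2 ⟨V, Finset.mem_filter.2 ⟨hV, hx⟩⟩
  rw [ordAt_eq_card]
  have : (1 : ℝ) ≤ ((𝒱.filter (fun V => x ∈ V)).card : ℝ) := by exact_mod_cast this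
  linarith

/-- Lower semicontinuity, because the members are open; hence the pairs of small total order form a
closed set. -/
theorem eventually_ordAt_le [TopologicalSpace X] {𝒱 : Finset (Set X)} (h𝒱 : 𝒱 ∈ Cov X) (x : X) :
    ∀ᶠ x' in nhds x, ordAt 𝒱 x ≤ ordAt 𝒱 x' := by
  have : ∀ V ∈ 𝒱, ∀ᶠ x' in nhds x,
      V.indicator (fun _ => (1 : ℝ)) x ≤ V.indicator (fun _ => (1 : ℝ)) x' := by
    intro V hV
    by_cases hx : x ∈ V
    · filter_upwards [(h𝒱.1 V hV).mem_nhds hx] with x' hx'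
      simp [hx, hx']
    · refine Filter.Eventually.of_forall fun x' => ?_
      rw [Set.indicator_of_notMem hx]
      exact Set.indicator_nonneg (fun _ _ => zero_le_one) _
  filter_upwards [(Finset.eventually_all 𝒱).2 this] with x' hx'
  exact add_le_add le_rfl (Finset.sum_le_sum hx')

theorem integrable_ordAt [TopologicalSpace X] [MeasurableSpace X] [OpensMeasurableSpace X]
    {𝒱 : Finset (Set X)} (h𝒱 : 𝒱 ∈ Cov X) (μ : Measure X) [IsFiniteMeasure μ] :
    Integrable (ordAt 𝒱) μ := by
  unfold ordAt
  exact (integrable_const _).add (integrable_finsetSum _ fun V hV =>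
    (integrable_const _).indicator (h𝒱.1 V hV).measurableSet)

end Order

/-! ### Maps separating points of small order -/

section Separation

variable {X K : Type*} [MetricSpace X] [TopologicalSpace K]

/-- `f` separates `ε`-distant points of small total order with respect to the cover `𝒱`. -/
def Separates (f : X → K) (𝒱 : Finset (Set X)) (r ε : ℝ) : Prop :=
  ∀ x y, ordAt 𝒱 x + ordAt 𝒱 y < r → f x = f y → dist x y < ε

/-- The pairs of small total order at distance at least `ε` form a compact set, which `f × f` must
send into the open complement of the diagonal. -/
theorem isOpen_separates [CompactSpace X] [T2Space K] {𝒱 : Finset (Set X)} (h𝒱 : 𝒱 ∈ Cov X)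
    (r ε : ℝ) : IsOpen {f : C(X, K) | Separates f 𝒱 r ε} := by
  set A : Set (X × X) := {p | r ≤ ordAt 𝒱 p.1 + ordAt 𝒱 p.2} with hA
  have hAo : IsOpen A := by
    refine isOpen_iff_mem_nhds.2 fun p (hp : r ≤ _) => ?_
    filter_upwards [(continuous_fst.tendsto p).eventually (eventually_ordAt_le h𝒱 p.1),
      (continuous_snd.tendsto p).eventually (eventually_ordAt_le h𝒱 p.2)] with p' h1 h2
    exact hp.trans (add_le_add h1 h2)
  have hK : IsCompact (Aᶜ ∩ {p : X × X | ε ≤ dist p.1 p.2}) :=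
    (hAo.isClosed_compl.inter (isClosed_le continuous_const continuous_dist)).isCompact
  have hcont : Continuous fun f : C(X, K) => f.prodMap f :=
    ContinuousMap.continuous_of_continuous_uncurry _ (by
      change Continuous fun q : C(X, K) × (X × X) => (q.1 q.2.1, q.1 q.2.2)
      fun_prop)
  convert (ContinuousMap.isOpen_setOfPred_mapsTo hK
    (isClosed_diagonal (X := K)).isOpen_compl).preimage hcont using 1
  ext f
  simp only [Set.mem_ofPred_eq, Set.mem_preimage, Separates, Set.MapsTo, hA, Prod.forall,
    Set.mem_inter_iff, Set.mem_compl_iff, not_le, Set.mem_diagonal_iff,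
    ContinuousMap.prodMap_apply, Prod.map]
  refine forall₂_congr fun x y => ⟨fun h ⟨h1, h2⟩ h3 => ?_, fun h h1 h2 => ?_⟩
  · exact (h h1 h3).not_ge h2
  · by_contra hcon
    exact h ⟨h1, not_lt.1 hcon⟩ h2

theorem exists_separates_near [CompactSpace X] {d : ℕ} (f : C(X, Fin d → unitInterval))
    {𝒱 : Finset (Set X)} (h𝒱 : 𝒱 ∈ Cov X) {δ ε : ℝ} (hδ : 0 < δ)
    (hdist : ∀ V ∈ 𝒱, ∀ x ∈ V, ∀ y ∈ V, dist x y < ε)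
    (hosc : ∀ V ∈ 𝒱, ∀ x ∈ V, ∀ y ∈ V, dist (f x) (f y) < δ) :
    ∃ g : C(X, Fin d → unitInterval), dist g f < 3 * δ ∧ Separates g 𝒱 d ε := by
  classical
  -- The value at an empty member is irrelevant: its partition function vanishes.
  obtain ⟨p, hpq, hp⟩ := exists_generalPosition_unitCube (d := d) 𝒱
    (fun V => if h : V.Nonempty then f h.some else 0) hδ
  obtain ⟨φ, hφ⟩ := PartitionOfUnity.exists_isSubordinate (s := (Set.univ : Set X)) isClosed_univ
    (fun V : 𝒱 => (V : Set X)) (fun V => h𝒱.1 V V.2) (fun x _ => by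
      obtain ⟨V, hV, hx⟩ := h𝒱.2 x
      exact Set.mem_iUnion.2 ⟨⟨V, hV⟩, hx⟩)
  have hsupp : ∀ (V : 𝒱) x, φ V x ≠ 0 → x ∈ (V : Set X) := fun V x hx =>
    hφ V (subset_tsupport _ hx)
  have hsum1 : ∀ x, ∑ V, φ V x = 1 := fun x => by
    rw [← finsum_eq_sum_of_fintype]; exact φ.sum_eq_one (Set.mem_univ x)
  have hfar : ∀ (V : 𝒱) x, x ∈ (V : Set X) → dist (p V) (f x) < 2 * δ := fun V x hx => by
    have hne : (V : Set X).Nonempty := ⟨x, hx⟩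
    have h1 := hpq V
    rw [dif_pos hne] at h1
    have h2 := hosc V V.2 _ hne.some_mem x hx
    linarith [dist_triangle (p V) (f hne.some) (f x)]
  let g : C(X, Fin d → unitInterval) :=
    { toFun := fun x j => ⟨∑ V, φ V x * p V j,
        Finset.sum_nonneg fun V _ => mul_nonneg (φ.nonneg V x) (p V j).2.1,
        (Finset.sum_le_sum fun V _ =>
          mul_le_of_le_one_right (φ.nonneg V x) (p V j).2.2).trans (hsum1 x).le⟩
      continuous_toFun := by fun_prop }
  have hg : ∀ x j, (g x j : ℝ) = ∑ V, φ V x * p V j := fun x j => rfl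
  refine ⟨g, ?_, fun x y hxy hgxy => ?_⟩
  · refine (ContinuousMap.dist_lt_iff (by linarith)).2 fun x =>
      ((dist_pi_le_iff (by linarith : (0 : ℝ) ≤ 2 * δ)).2 fun j => ?_).trans_lt (by linarith)
    rw [Subtype.dist_eq, Real.dist_eq, hg]
    have : ∑ V, φ V x * (p V j : ℝ) - f x j = ∑ V, φ V x * ((p V j : ℝ) - f x j) := by
      simp_rw [mul_sub]
      rw [Finset.sum_sub_distrib, ← Finset.sum_mul, hsum1, one_mul]
    rw [this]
    refine (Finset.abs_sum_le_sum_abs _ _).trans ?_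
    calc ∑ V, |φ V x * ((p V j : ℝ) - f x j)| ≤ ∑ V, φ V x * (2 * δ) := by
          refine Finset.sum_le_sum fun V _ => ?_
          rw [abs_mul, abs_of_nonneg (φ.nonneg V x)]
          by_cases h0 : φ V x = 0
          · simp [h0]
          refine mul_le_mul_of_nonneg_left ?_ (φ.nonneg V x)
          exact (dist_le_pi_dist (p V) (f x) j).trans (hfar V x (hsupp V x h0)).le
      _ = 2 * δ := by rw [← Finset.sum_mul, hsum1, one_mul]
  -- The weights of the affine relation expressed by `g x = g y`; if they all vanish, `x` and `y`
  -- lie in a common member.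
  · let w : Set X → ℝ := fun V => if h : V ∈ 𝒱 then φ ⟨V, h⟩ x - φ ⟨V, h⟩ y else 0
    have hw : ∀ V : 𝒱, w V = φ V x - φ V y := fun V => dif_pos V.2
    have key := hp w ?_ ?_ ?_
    · obtain ⟨V, hV⟩ : ∃ V, φ V x ≠ 0 := by
        by_contra! h
        simpa [h] using hsum1 x
      have hVy : φ V y ≠ 0 := by
        have := key V V.2
        rw [hw, sub_eq_zero] at this
        rwa [← this]
      exact hdist V V.2 x (hsupp V x hV) y (hsupp V y hVy)
    · rw [← Finset.sum_coe_sort]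
      simp_rw [hw]
      rw [Finset.sum_sub_distrib, hsum1, hsum1, sub_self]
    · intro j
      rw [← Finset.sum_coe_sort 𝒱 (fun V => w V * (p V j : ℝ))]
      simp_rw [hw, sub_mul]
      rw [Finset.sum_sub_distrib, ← hg, ← hg, hgxy, sub_self]
    · rw [ordAt_eq_card, ordAt_eq_card] at hxy
      have h1 : (𝒱.filter (fun V => w V ≠ 0)) ⊆
          𝒱.filter (fun V => x ∈ V) ∪ 𝒱.filter (fun V => y ∈ V) := by
        intro V hV
        obtain ⟨hV, hwV⟩ := Finset.mem_filter.1 hV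
        by_contra hcon
        simp only [Finset.mem_union, Finset.mem_filter, hV, true_and, not_or] at hcon
        apply hwV
        rw [hw ⟨V, hV⟩, not_not.1 (mt (hsupp ⟨V, hV⟩ x) hcon.1),
          not_not.1 (mt (hsupp ⟨V, hV⟩ y) hcon.2), sub_self]
      have h2 := (Finset.card_le_card h1).trans (Finset.card_union_le _ _)
      -- The `-1` in each order accounts for the `2`; strictness then leaves at most `d + 1`
      -- members.
      have h3 : (𝒱.filter (fun V => x ∈ V)).card + (𝒱.filter (fun V => y ∈ V)).card < d + 2 := by
        have : (((𝒱.filter (fun V => x ∈ V)).card + (𝒱.filter (fun V => y ∈ V)).card : ℕ) : ℝ)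
            < ((d + 2 : ℕ) : ℝ) := by push_cast; linarith
        exact_mod_cast this
      omega

theorem exists_cov_small [CompactSpace X] {L : Type*} [PseudoMetricSpace L] (f : C(X, L))
    {δ ε : ℝ} (hδ : 0 < δ) (hε : 0 < ε) :
    ∃ 𝒰 ∈ Cov X, ∀ U ∈ 𝒰, ∀ x ∈ U, ∀ y ∈ U, dist x y < ε ∧ dist (f x) (f y) < δ := by
  classical
  let W : X → Set X := fun x => Metric.ball x (ε / 2) ∩ f ⁻¹' Metric.ball (f x) (δ / 2)
  have hWo : ∀ x, IsOpen (W x) := fun x =>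
    Metric.isOpen_ball.inter (Metric.isOpen_ball.preimage f.continuous)
  have hWx : ∀ x, x ∈ W x := fun x => ⟨Metric.mem_ball_self (by linarith),
    Metric.mem_ball_self (by linarith)⟩
  obtain ⟨t, ht⟩ := (isCompact_univ (X := X)).elim_finite_subcover W hWo
    fun x _ => Set.mem_iUnion.2 ⟨x, hWx x⟩
  refine ⟨t.image W, ⟨fun U hU => ?_, fun x => ?_⟩, fun U hU x hx y hy => ?_⟩
  · obtain ⟨x, -, rfl⟩ := Finset.mem_image.1 hU
    exact hWo x
  · obtain ⟨y, hy, hxy⟩ := Set.mem_iUnion₂.1 (ht (Set.mem_univ x))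
    exact ⟨W y, Finset.mem_image_of_mem _ hy, hxy⟩
  · obtain ⟨z, -, rfl⟩ := Finset.mem_image.1 hU
    have h1 := Metric.mem_ball.1 hx.1
    have h2 := Metric.mem_ball.1 hy.1
    have h3 := Metric.mem_ball.1 hx.2
    have h4 := Metric.mem_ball.1 hy.2
    exact ⟨by linarith [dist_triangle_right x y z],
      by linarith [dist_triangle_right (f x) (f y) (f z)]⟩

end Separation

/-! ### Openness and density of the separating maps -/

section Generic

variable {X : Type*} [MetricSpace X] [MeasurableSpace X]

/-- The maps separating `ε`-distant points of small total order with respect to some cover whose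
order with respect to `P` is less than `c`. -/
def separatingMaps (P : Set (ProbabilityMeasure X)) (c : EReal) (d : ℕ) (ε : ℝ) :
    Set C(X, Fin d → unitInterval) :=
  {f | ∃ 𝒱 ∈ Cov X, ordOf 𝒱 P < c ∧ Separates f 𝒱 d ε}

variable [CompactSpace X]

theorem isOpen_separatingMaps (P : Set (ProbabilityMeasure X)) (c : EReal) (d : ℕ) (ε : ℝ) :
    IsOpen (separatingMaps P c d ε) := by
  have : separatingMaps P c d ε = ⋃ 𝒱 ∈ {𝒱 ∈ Cov X | ordOf 𝒱 P < c},
      {f : C(X, Fin d → unitInterval) | Separates f 𝒱 d ε} := by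
    ext f
    simp [separatingMaps, and_assoc]
  rw [this]
  exact isOpen_biUnion fun 𝒱 h => isOpen_separates h.1 _ _

theorem dense_separatingMaps {P : Set (ProbabilityMeasure X)} {c : EReal} (hc : dimPair P < c)
    (d : ℕ) {ε : ℝ} (hε : 0 < ε) : Dense (separatingMaps P c d ε) := by
  refine Metric.dense_iff.2 fun f r hr => ?_
  obtain ⟨𝒰, h𝒰, hsmall⟩ := exists_cov_small f (δ := r / 3) (by linarith) hε
  have hlt : dimCover 𝒰 P < c := (le_iSup₂ (f := fun 𝒰 _ => dimCover 𝒰 P) 𝒰 h𝒰).trans_lt hc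
  simp only [dimCover, iInf_lt_iff] at hlt
  obtain ⟨𝒱, ⟨h𝒱, href⟩, hord⟩ := hlt
  have hV : ∀ V ∈ 𝒱, ∀ x ∈ V, ∀ y ∈ V, dist x y < ε ∧ dist (f x) (f y) < r / 3 :=
    fun V hV x hx y hy => by
      obtain ⟨U, hU, hVU⟩ := href V hV
      exact hsmall U hU x (hVU hx) y (hVU hy)
  obtain ⟨g, hg, hsep⟩ := exists_separates_near f h𝒱 (δ := r / 3) (ε := ε) (by linarith)
    (fun V h x hx y hy => (hV V h x hx y hy).1) (fun V h x hx y hy => (hV V h x hx y hy).2)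
  exact ⟨g, by rw [Metric.mem_ball]; linarith, 𝒱, h𝒱, hord, hsep⟩

end Generic

/-! ### Joinings over `f` charge the diagonal -/

section Joining

open ProbabilityTheory

theorem integral_ordAt_le_of_ordOf_lt {X : Type*} [TopologicalSpace X] [MeasurableSpace X]
    {𝒱 : Finset (Set X)} {P : Set (ProbabilityMeasure X)} {c : ℝ} (h : ordOf 𝒱 P < (c : EReal))
    {μ : ProbabilityMeasure X} (hμ : μ ∈ P) : ∫ x, ordAt 𝒱 x ∂(μ : Measure X) ≤ c := by
  have := (le_iSup₂ (f := fun (μ : ProbabilityMeasure X) (_ : μ ∈ P) =>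
    ((∫ x, ordAt 𝒱 x ∂(μ : Measure X) : ℝ) : EReal)) μ hμ).trans_lt h
  exact (EReal.coe_lt_coe_iff.1 this).le

variable {X : Type*} [MetricSpace X] [MeasurableSpace X] [BorelSpace X]

/-- Markov's inequality for the sum of the orders, whose mean is at most `2c`. Keeping the factor
`d` avoids a division and covers `d = 0`. The bound does not depend on `ε`, so it survives `ε → 0`.
-/
theorem le_measureReal_dist_lt_of_mem_separatingMaps {P : Set (ProbabilityMeasure X)} {c : ℝ}
    {d : ℕ} {ε : ℝ} {f : C(X, Fin d → unitInterval)} (hf : f ∈ separatingMaps P c d ε)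
    (lam : Measure (X × X)) [IsProbabilityMeasure lam] {μ ν : ProbabilityMeasure X}
    (hμ : μ ∈ P) (hν : ν ∈ P) (hfst : lam.map Prod.fst = μ) (hsnd : lam.map Prod.snd = ν)
    (hlam : ∀ᵐ p ∂lam, f p.1 = f p.2) :
    (d : ℝ) - 2 * c ≤ d * lam.real {p | dist p.1 p.2 < ε} := by
  obtain ⟨𝒱, h𝒱, hord, hsep⟩ := hf
  have hi := integrable_ordAt h𝒱 (μ : Measure X)
  have hi' := integrable_ordAt h𝒱 (ν : Measure X)
  have h1 := integral_ordAt_le_of_ordOf_lt hord hμ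
  have h2 := integral_ordAt_le_of_ordOf_lt hord hν
  rw [← hfst] at h1 hi
  rw [← hsnd] at h2 hi'
  rw [integral_map measurable_fst.aemeasurable hi.aestronglyMeasurable] at h1
  rw [integral_map measurable_snd.aemeasurable hi'.aestronglyMeasurable] at h2
  replace hi := hi.comp_measurable measurable_fst
  replace hi' := hi'.comp_measurable measurable_snd
  have hmarkov := mul_meas_ge_le_integral_of_nonneg
    (Filter.Eventually.of_forall fun p : X × X =>
      add_nonneg (ordAt_nonneg h𝒱 p.1) (ordAt_nonneg h𝒱 p.2)) (hi.add hi') d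
  have hadd := integral_add hi hi'
  simp only [Function.comp_apply] at hadd
  have hcover : lam.real Set.univ ≤ lam.real {p | dist p.1 p.2 < ε} +
      lam.real {p | (d : ℝ) ≤ ordAt 𝒱 p.1 + ordAt 𝒱 p.2} := by
    refine le_trans ?_ (measureReal_union_le _ _)
    refine ENNReal.toReal_mono (measure_ne_top _ _) (measure_mono_ae ?_)
    filter_upwards [hlam] with p hp _
    rcases lt_or_ge (ordAt 𝒱 p.1 + ordAt 𝒱 p.2) d with h | h
    · exact Or.inl (hsep _ _ h hp)
    · exact Or.inr h
  rw [probReal_univ] at hcover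
  have hmarkov' : (d : ℝ) * lam.real {p : X × X | (d : ℝ) ≤ ordAt 𝒱 p.1 + ordAt 𝒱 p.2} ≤ 2 * c :=
    hmarkov.trans (by
      refine le_of_eq_of_le hadd ?_
      linarith)
  nlinarith [mul_le_mul_of_nonneg_left hcover (Nat.cast_nonneg (α := ℝ) d)]

theorem measure_diagonal_ne_zero [CompactSpace X] {P : Set (ProbabilityMeasure X)} {c : ℝ} {d : ℕ}
    (hc : 2 * c < d) {f : C(X, Fin d → unitInterval)}
    (hf : ∀ n : ℕ, f ∈ separatingMaps P c d (1 / (n + 1)))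
    (lam : Measure (X × X)) [IsProbabilityMeasure lam] {μ ν : ProbabilityMeasure X}
    (hμ : μ ∈ P) (hν : ν ∈ P) (hfst : lam.map Prod.fst = μ) (hsnd : lam.map Prod.snd = ν)
    (hlam : ∀ᵐ p ∂lam, f p.1 = f p.2) : lam (Set.diagonal X) ≠ 0 := by
  intro h0
  have hanti : Antitone fun n : ℕ => {p : X × X | dist p.1 p.2 < 1 / ((n : ℝ) + 1)} :=
    fun m n hmn p (hp : dist p.1 p.2 < _) => lt_of_lt_of_le hp (Nat.one_div_le_one_div hmn)
  have hinter : ⋂ n : ℕ, {p : X × X | dist p.1 p.2 < 1 / ((n : ℝ) + 1)} = Set.diagonal X := by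
    ext p
    simp only [Set.mem_iInter, Set.mem_ofPred_eq, Set.mem_diagonal_iff]
    refine ⟨fun h => ?_, fun h n => ?_⟩
    · by_contra hne
      obtain ⟨n, hn⟩ := exists_nat_one_div_lt (dist_pos.2 hne)
      exact (hn.trans (h n)).false
    · rw [h, dist_self]
      exact Nat.one_div_pos_of_nat
  have hlim := tendsto_measure_iInter_atTop (μ := lam)
    (fun n : ℕ => (measurableSet_lt (measurable_fst.dist measurable_snd)
      (measurable_const (a := 1 / ((n : ℝ) + 1)))).nullMeasurableSet) hanti
    ⟨0, measure_ne_top _ _⟩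
  rw [hinter, h0] at hlim
  have hlim' := (((ENNReal.tendsto_toReal ENNReal.zero_ne_top).comp hlim).const_mul (d : ℝ))
  rw [ENNReal.toReal_zero, mul_zero] at hlim'
  have := ge_of_tendsto' hlim' fun n =>
    le_measureReal_dist_lt_of_mem_separatingMaps (hf n) lam hμ hν hfst hsnd hlam
  linarith

end Joining

/-! ### The relatively independent self-joining -/

section SelfJoining

open ProbabilityTheory

variable {X Y : Type*} [MeasurableSpace X] [StandardBorelSpace X] [Nonempty X]
  [MeasurableSpace Y]

/-- The relatively independent self-joining of `μ` over the map `f`. -/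
noncomputable def selfJoining (μ : Measure X) [IsFiniteMeasure μ] (f : X → Y) :
    Measure (X × X) :=
  (μ.map f).bind (condDistrib id f μ ×ₖ condDistrib id f μ)

variable (μ : Measure X) [IsProbabilityMeasure μ] {f : X → Y}

theorem setLIntegral_condDistrib_id (hf : Measurable f) {A : Set X} (hA : MeasurableSet A)
    {C : Set Y} (hC : MeasurableSet C) :
    ∫⁻ y in C, condDistrib id f μ y A ∂(μ.map f) = μ (f ⁻¹' C ∩ A) := by
  rw [← Measure.compProd_apply_prod hC hA, compProd_map_condDistrib measurable_id.aemeasurable,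
    Measure.map_apply (hf.prodMk measurable_id) (hC.prod hA)]
  rfl

theorem selfJoining_prod {A B : Set X} (hA : MeasurableSet A) (hB : MeasurableSet B) :
    selfJoining μ f (A ×ˢ B) =
      ∫⁻ y, condDistrib id f μ y A * condDistrib id f μ y B ∂(μ.map f) := by
  rw [selfJoining, Measure.bind_apply (hA.prod hB) (Kernel.aemeasurable _)]
  simp [Kernel.prod_apply]

theorem isProbabilityMeasure_selfJoining (hf : Measurable f) :
    IsProbabilityMeasure (selfJoining μ f) := by
  have := Measure.isProbabilityMeasure_map (μ := μ) hf.aemeasurable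
  refine ⟨?_⟩
  rw [← Set.univ_prod_univ, selfJoining_prod μ .univ .univ]
  simp

/-- Almost every conditional measure is carried by its own fibre of `f`. -/
theorem ae_selfJoining_eq (hf : Measurable f) (hdiag : MeasurableSet (Set.diagonal Y)) :
    ∀ᵐ p ∂(selfJoining μ f), f p.1 = f p.2 := by
  have := Measure.isProbabilityMeasure_map (μ := μ) hf.aemeasurable
  have h1 : ∀ᵐ q ∂((μ.map f) ⊗ₘ condDistrib id f μ), q.1 = f q.2 := by
    rw [compProd_map_condDistrib measurable_id.aemeasurable,
      ae_map_iff (p := fun q => q.1 = f q.2) (hf.prodMk measurable_id).aemeasurable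
        ((measurable_fst.prodMk (hf.comp measurable_snd)) hdiag)]
    exact Filter.Eventually.of_forall fun _ => rfl
  have h2 := Measure.ae_ae_of_ae_compProd h1
  have hm : MeasurableSet {p : X × X | f p.1 = f p.2}ᶜ :=
    ((hf.comp measurable_fst).prodMk (hf.comp measurable_snd) hdiag).compl
  change selfJoining μ f {p : X × X | f p.1 = f p.2}ᶜ = 0
  rw [selfJoining, Measure.bind_apply hm (Kernel.aemeasurable _)]
  refine (lintegral_congr_ae ?_).trans lintegral_zero
  filter_upwards [h2] with y hy
  rw [Kernel.prod_apply]
  change ∀ᵐ p ∂((condDistrib id f μ y).prod (condDistrib id f μ y)), f p.1 = f p.2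
  filter_upwards [Measure.quasiMeasurePreserving_fst.ae hy,
    Measure.quasiMeasurePreserving_snd.ae hy] with p h3 h4
  rw [← h3, ← h4]

theorem map_selfJoining (hf : Measurable f) (T : X ≃ᵐ X) (S : Y ≃ᵐ Y)
    (hfT : ∀ x, f (T x) = S (f x)) (hT : μ.map T = μ) :
    (selfJoining μ f).map (Prod.map T T) = selfJoining μ f := by
  have := Measure.isProbabilityMeasure_map (μ := μ) hf.aemeasurable
  have := isProbabilityMeasure_selfJoining μ hf
  have hS : (μ.map f).map S = μ.map f := by
    conv_rhs => rw [← hT]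
    rw [Measure.map_map S.measurable hf, Measure.map_map hf T.measurable]
    congr 1
    ext x
    exact (hfT x).symm
  -- Equivariance of the disintegration: both sides have the same integral over every `C`.
  have hcov : ∀ A, MeasurableSet A → (fun y => condDistrib id f μ y (T ⁻¹' A)) =ᵐ[μ.map f]
      fun y => condDistrib id f μ (S y) A := by
    intro A hA
    refine ae_eq_of_forall_setLIntegral_eq_of_sigmaFinite
      (Kernel.measurable_coe _ (T.measurable hA))
      ((Kernel.measurable_coe _ hA).comp S.measurable) fun C hC _ => ?_
    rw [setLIntegral_condDistrib_id μ hf (T.measurable hA) hC]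
    have hC' : MeasurableSet (S.symm ⁻¹' C) := S.symm.measurable hC
    have h1 : S ⁻¹' (S.symm ⁻¹' C) = C := by ext; simp
    calc μ (f ⁻¹' C ∩ T ⁻¹' A) = μ (T ⁻¹' (f ⁻¹' (S.symm ⁻¹' C) ∩ A)) := by
          congr 1
          ext x
          simp [hfT]
      _ = μ (f ⁻¹' (S.symm ⁻¹' C) ∩ A) := by
          conv_rhs => rw [← hT]
          rw [Measure.map_apply T.measurable ((hf hC').inter hA)]
      _ = ∫⁻ y in S.symm ⁻¹' C, condDistrib id f μ y A ∂((μ.map f).map S) := by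
          rw [hS, setLIntegral_condDistrib_id μ hf hA hC']
      _ = _ := by
          rw [setLIntegral_map hC' (Kernel.measurable_coe _ hA) S.measurable, h1]
  have hTT : Measurable (Prod.map T T) := T.measurable.prodMap T.measurable
  have := Measure.isProbabilityMeasure_map (μ := selfJoining μ f) hTT.aemeasurable
  refine Measure.ext_prod fun {A B} hA hB => ?_
  rw [Measure.map_apply hTT (hA.prod hB), Set.preimage_prod_map_prod,
    selfJoining_prod μ (T.measurable hA) (T.measurable hB), selfJoining_prod μ hA hB]
  conv_rhs => rw [← hS]
  refine Eq.trans (lintegral_congr_ae ?_) (lintegral_map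
    ((Kernel.measurable_coe _ hA).mul (Kernel.measurable_coe _ hB)) S.measurable).symm
  filter_upwards [hcov A hA, hcov B hB] with y h1 h2
  rw [Pi.mul_apply, ← h1, ← h2]

/-- The hypothesis says that `κ_y(A) κ_y(Aᶜ) = 0` for almost every `y`, where `κ` is the
disintegration; so `C = {κ_y(A) ≠ 0}` works. -/
theorem exists_measure_symmDiff_eq_zero_of_selfJoining (hf : Measurable f)
    {A : Set X} (hA : MeasurableSet A) (h : selfJoining μ f (A ×ˢ Aᶜ) = 0) :
    ∃ C, MeasurableSet C ∧ μ (symmDiff A (f ⁻¹' C)) = 0 := by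
  have := Measure.isProbabilityMeasure_map (μ := μ) hf.aemeasurable
  rw [selfJoining_prod μ hA hA.compl] at h
  replace h := (lintegral_eq_zero_iff
    ((Kernel.measurable_coe _ hA).mul (Kernel.measurable_coe _ hA.compl))).1 h
  have hC : MeasurableSet {y | condDistrib id f μ y A = 0} :=
    Kernel.measurable_coe _ hA (measurableSet_singleton 0)
  refine ⟨{y | condDistrib id f μ y A = 0}ᶜ, hC.compl, ?_⟩
  rw [Set.symmDiff_def]
  refine measure_union_null ?_ ?_
  · have : A \ f ⁻¹' {y | condDistrib id f μ y A = 0}ᶜ =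
        f ⁻¹' {y | condDistrib id f μ y A = 0} ∩ A := by
      ext x; simp [and_comm]
    rw [this, ← setLIntegral_condDistrib_id μ hf hA hC]
    exact (setLIntegral_congr_fun hC fun y hy => hy).trans lintegral_zero
  · rw [Set.sdiff_eq, ← setLIntegral_condDistrib_id μ hf hA.compl hC.compl]
    refine (setLIntegral_congr_fun_ae hC.compl ?_).trans lintegral_zero
    filter_upwards [h] with y hy hyC
    exact (mul_eq_zero.1 hy).resolve_left hyC

end SelfJoining

/-! ### From the diagonal to a measure isomorphism -/

section MeasureIso

variable {X Y : Type*} [MeasurableSpace Y]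

/-- Off a null set, `f x` determines which sets of a countable basis contain `x`, and these separate
points. -/
theorem exists_injOn_of_selfJoining_diagonal [TopologicalSpace X] [SecondCountableTopology X]
    [T1Space X] [MeasurableSpace X] [BorelSpace X] [StandardBorelSpace X] [Nonempty X]
    (μ : Measure X) [IsProbabilityMeasure μ] {f : X → Y} (hf : Measurable f)
    (h : selfJoining μ f (Set.diagonal X)ᶜ = 0) :
    ∃ A, MeasurableSet A ∧ μ Aᶜ = 0 ∧ Set.InjOn f A := by
  have hB : ∀ B ∈ TopologicalSpace.countableBasis X, MeasurableSet B := fun B hB =>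
    (TopologicalSpace.isOpen_of_mem_countableBasis hB).measurableSet
  choose! C hC hμC using fun B (h' : B ∈ TopologicalSpace.countableBasis X) =>
    exists_measure_symmDiff_eq_zero_of_selfJoining μ hf (hB B h')
      (measure_mono_null (fun p hp hd => hp.2 ((Set.mem_diagonal_iff.1 hd) ▸ hp.1)) h)
  have hcount := TopologicalSpace.countable_countableBasis X
  refine ⟨(⋃ B ∈ TopologicalSpace.countableBasis X, symmDiff B (f ⁻¹' C B))ᶜ,
    (MeasurableSet.biUnion hcount fun B h' => (hB B h').symmDiff (hf (hC B h'))).compl, ?_, ?_⟩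
  · rw [compl_compl]
    exact (measure_biUnion_null_iff hcount).2 hμC
  · have key : ∀ x ∈ (⋃ B ∈ TopologicalSpace.countableBasis X, symmDiff B (f ⁻¹' C B))ᶜ,
        ∀ B ∈ TopologicalSpace.countableBasis X, (x ∈ B ↔ f x ∈ C B) := by
      intro x hx B hB
      simp only [Set.mem_compl_iff, Set.mem_iUnion, not_exists] at hx
      have := hx B hB
      rw [Set.mem_symmDiff, Set.mem_preimage] at this
      tauto
    intro x hx y hy hxy
    by_contra hne
    obtain ⟨B, hBb, hxB, hBy⟩ := (TopologicalSpace.isBasis_countableBasis X).exists_subset_of_mem_open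
      (show x ∈ ({y}ᶜ : Set X) from hne) isOpen_compl_singleton
    exact hBy ((key y hy B hBb).2 (hxy ▸ (key x hx B hBb).1 hxB)) rfl

/-- Countably many translates of `A` meet in an invariant conull set; by Lusin–Souslin its image is
Borel and the inverse measurable. -/
theorem inducesMeasureIso_of_injOn {Γ : Type*} [Group Γ] [Countable Γ] [TopologicalSpace X]
    [MeasurableSpace X] [BorelSpace X] [StandardBorelSpace X] [TopologicalSpace Y]
    [MeasurableSpace.CountablySeparated Y] {T : Γ →* (X ≃ₜ X)} {S : Γ →* (Y ≃ₜ Y)}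
    {μ : Measure X} (hμ : ∀ γ, μ.map (T γ) = μ) {f : X → Y} (hf : Measurable f)
    (hequiv : ∀ γ x, f (T γ x) = S γ (f x)) {A : Set X} (hA : MeasurableSet A)
    (hA0 : μ Aᶜ = 0) (hinj : Set.InjOn f A) : InducesMeasureIso T S μ f := by
  have hTT : ∀ γ γ' x, T γ (T γ' x) = T (γ * γ') x := fun γ γ' x => by rw [map_mul]; rfl
  have hpre : ∀ γ, μ (T γ ⁻¹' A)ᶜ = 0 := fun γ => by
    rw [← Set.preimage_compl, ← Measure.map_apply (T γ).measurable hA.compl, hμ, hA0]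
  set X₀ : Set X := ⋂ γ, T γ ⁻¹' A with hX₀
  have hX₀m : MeasurableSet X₀ := MeasurableSet.iInter fun γ => (T γ).measurable hA
  have hX₀A : X₀ ⊆ A := fun x hx => by
    simpa using Set.mem_iInter.1 hx 1
  have hX₀inv : ∀ γ, ∀ x ∈ X₀, T γ x ∈ X₀ := fun γ x hx => Set.mem_iInter.2 fun γ' => by
    rw [Set.mem_preimage, hTT]
    exact Set.mem_iInter.1 hx _
  have hTX₀ : ∀ γ, T γ '' X₀ = X₀ := fun γ => by
    refine Set.Subset.antisymm (Set.image_subset_iff.2 (hX₀inv γ)) fun x hx =>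
      ⟨T γ⁻¹ x, hX₀inv _ x hx, ?_⟩
    rw [hTT, mul_inv_cancel, map_one]
    rfl
  have hinj₀ : Set.InjOn f X₀ := hinj.mono hX₀A
  have hY₀m : MeasurableSet (f '' X₀) := hX₀m.image_of_measurable_injOn hf hinj₀
  have hX₀0 : μ X₀ᶜ = 0 := by
    rw [hX₀, Set.compl_iInter]
    exact measure_iUnion_null hpre
  have := hX₀m.standardBorel
  have hemb : MeasurableEmbedding (X₀.domRestrict f) :=
    (hf.comp measurable_subtype_coe).measurableEmbedding (Set.injOn_iff_injective.1 hinj₀)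
  have hrange : Set.range (X₀.domRestrict f) = f '' X₀ := Set.range_domRestrict f X₀
  refine ⟨hf, X₀, Set.range (X₀.domRestrict f), hX₀m, hrange ▸ hY₀m, hX₀0, ?_, hTX₀, fun γ => ?_, fun γ x _ => hequiv γ x,
    hemb.equivRange, fun x => by rw [hemb.equivRange_apply]; rfl⟩
  · rw [hrange, Measure.map_apply hf hY₀m.compl]
    exact measure_mono_null (fun x hx hx₀ => hx ⟨x, hx₀, rfl⟩) hX₀0
  · rw [hrange, Set.image_image]
    simp_rw [← hequiv]
    rw [← Set.image_image f, hTX₀]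

end MeasureIso

/-! ### The orbit map -/

section Orbit

variable {Γ : Type*} [Group Γ] {X K : Type*} [TopologicalSpace X]

theorem orbitMap_equivariant [TopologicalSpace K] (T : Γ →* (X ≃ₜ X)) (f : X → K) (γ : Γ)
    (x : X) : orbitMap T f (T γ x) = shift Γ K γ (orbitMap T f x) := by
  funext γ'
  change f (T γ'⁻¹ (T γ x)) = f (T (γ⁻¹ * γ')⁻¹ x)
  rw [mul_inv_rev, inv_inv, map_mul]
  rfl

theorem continuous_orbitMap [TopologicalSpace K] (T : Γ →* (X ≃ₜ X)) {f : X → K}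
    (hf : Continuous f) : Continuous (orbitMap T f) :=
  continuous_pi fun γ => hf.comp (T γ⁻¹).continuous

end Orbit

/-! ### Generic maps give almost embeddings -/

section AlmostEmbedding

open ProbabilityTheory

variable {Γ : Type*} [Group Γ] {X : Type*} [MetricSpace X] [MeasurableSpace X] [BorelSpace X]

theorem map_marginal_mem_invProb (T : Γ →* (X ≃ₜ X)) {lam : Measure (X × X)}
    [IsProbabilityMeasure lam] (hlam : ∀ γ, lam.map (Prod.map (T γ) (T γ)) = lam)
    {π : X × X → X} (hπ : Measurable π) (hT : ∀ γ p, π (Prod.map (T γ) (T γ) p) = T γ (π p)) :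
    (⟨lam.map π, Measure.isProbabilityMeasure_map hπ.aemeasurable⟩ : ProbabilityMeasure X)
      ∈ invProb T := by
  intro γ
  change (lam.map π).map (T γ) = lam.map π
  rw [Measure.map_map (T γ).measurable hπ]
  conv_rhs => rw [← hlam γ]
  rw [Measure.map_map hπ ((T γ).measurable.prodMap (T γ).measurable)]
  congr 1
  ext p
  exact (hT γ p).symm

theorem selfJoining_compl_diagonal_eq_zero [CompactSpace X] [Nonempty X]
    (T : Γ →* (X ≃ₜ X)) {Y : Type*}
    [MeasurableSpace Y] (hdiag : MeasurableSet (Set.diagonal Y)) (S : Γ → Y ≃ᵐ Y)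
    {μ : ProbabilityMeasure X} (hμ : μ ∈ invProb T) {F : X → Y} (hF : Measurable F)
    (hequiv : ∀ γ x, F (T γ x) = S γ (F x)) {c : ℝ} {d : ℕ} (hc : 2 * c < d)
    {f : C(X, Fin d → unitInterval)} (hFf : ∀ x y, F x = F y → f x = f y)
    (hf : ∀ n : ℕ, f ∈ separatingMaps (invProb T) c d (1 / (n + 1))) :
    selfJoining (μ : Measure X) F (Set.diagonal X)ᶜ = 0 := by
  by_contra h0
  have := isProbabilityMeasure_selfJoining (μ : Measure X) hF
  have hprob := cond_isProbabilityMeasure h0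
  have hm : MeasurableSet (Set.diagonal X)ᶜ := isClosed_diagonal.measurableSet.compl
  have hae : ∀ᵐ p ∂(selfJoining (μ : Measure X) F)[|(Set.diagonal X)ᶜ], f p.1 = f p.2 := by
    refine cond_absolutelyContinuous.ae_le ?_
    filter_upwards [ae_selfJoining_eq (μ : Measure X) hF hdiag] with p hp
    exact hFf _ _ hp
  -- Each `T γ` is injective, so the complement of the diagonal is invariant and conditioning on it
  -- preserves invariance.
  have hinv : ∀ γ, ((selfJoining (μ : Measure X) F)[|(Set.diagonal X)ᶜ]).map
      (Prod.map (T γ) (T γ)) = (selfJoining (μ : Measure X) F)[|(Set.diagonal X)ᶜ] := by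
    intro γ
    have hpre : Prod.map (T γ) (T γ) ⁻¹' (Set.diagonal X)ᶜ = (Set.diagonal X)ᶜ := by
      ext p
      simp
    rw [ProbabilityTheory.cond, Measure.map_smul]
    conv_lhs => rw [← hpre]
    rw [← Measure.restrict_map ((T γ).measurable.prodMap (T γ).measurable) hm, hpre]
    congr 2
    exact map_selfJoining (μ : Measure X) hF (T γ).toMeasurableEquiv (S γ) (hequiv γ) (hμ γ)
  refine measure_diagonal_ne_zero hc hf _
    (map_marginal_mem_invProb T hinv measurable_fst fun _ _ => rfl)
    (map_marginal_mem_invProb T hinv measurable_snd fun _ _ => rfl) rfl rfl hae ?_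
  rw [cond_apply hm, Set.compl_inter_self, measure_empty, mul_zero]

theorem isAlmostEmbedding_orbitMap [CompactSpace X] [Countable Γ] (T : Γ →* (X ≃ₜ X)) {c : ℝ} {d : ℕ}
    (hc : 2 * c < d) {f : C(X, Fin d → unitInterval)}
    (hf : ∀ n : ℕ, f ∈ separatingMaps (invProb T) c d (1 / (n + 1))) :
    IsAlmostEmbedding T (shift Γ (Fin d → unitInterval)) (orbitMap T f) := by
  have hcont := continuous_orbitMap T f.continuous
  refine ⟨hcont, orbitMap_equivariant T f, fun μ hμ => ?_⟩
  have : Nonempty X := μ.nonempty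
  have hdiag : MeasurableSet (Set.diagonal (Γ → Fin d → unitInterval)) :=
    isClosed_diagonal.measurableSet
  obtain ⟨A, hA, hA0, hinj⟩ := exists_injOn_of_selfJoining_diagonal (μ : Measure X)
    hcont.measurable (selfJoining_compl_diagonal_eq_zero T hdiag
      (fun γ => (shift Γ (Fin d → unitInterval) γ).toMeasurableEquiv) hμ hcont.measurable
      (orbitMap_equivariant T f) hc
      (fun x y h => by simpa [orbitMap] using congrFun h 1) hf)
  exact inducesMeasureIso_of_injOn hμ hcont.measurable (orbitMap_equivariant T f) hA hA0 hinj

end AlmostEmbedding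

end DynDim

theorem theorem10p3 {Γ : Type*} [Group Γ] [Countable Γ]
    {X : Type*} [MetricSpace X] [CompactSpace X] [MeasurableSpace X] [BorelSpace X]
    (T : Γ →* (X ≃ₜ X)) (d : ℕ)
    (hd : DynDim.dimSys T < (((d : ℝ) / 2 : ℝ) : EReal)) :
    ∃ G : Set C(X, Fin d → unitInterval), IsGδ G ∧ Dense G ∧
      ∀ f ∈ G, DynDim.IsAlmostEmbedding T (DynDim.shift Γ (Fin d → unitInterval))
        (DynDim.orbitMap T f) := by
  -- One `c` serves all scales, which keeps the gap `d - 2c` uniform; dimension `-∞` is included.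
  obtain ⟨c, hTc, hcd⟩ := EReal.lt_iff_exists_real_btwn.1 hd
  have hc : 2 * c < d := by linarith [EReal.coe_lt_coe_iff.1 hcd]
  have hopen := fun n : ℕ =>
    DynDim.isOpen_separatingMaps (DynDim.invProb T) c d (1 / ((n : ℝ) + 1))
  exact ⟨⋂ n : ℕ, DynDim.separatingMaps (DynDim.invProb T) c d (1 / (n + 1)),
    IsGδ.iInter_of_isOpen hopen,
    dense_iInter_of_isOpen hopen fun n => DynDim.dense_separatingMaps hTc d Nat.one_div_pos_of_nat,
    fun f hf => DynDim.isAlmostEmbedding_orbitMap T hc (Set.mem_iInter.1 hf)⟩
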